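/- Let $n,d\ge 1$ be integers and let $|\psi\rangle_{A_1\cdots A_n}$ be an $n$-qudit GWV state, i.e. a unit vector of $(\mathbb C^d)^{\otimes n}$ of the form $$|\psi\rangle=\sqrt p\,\sum_{s=1}^{n}\sum_{i=1}^{d-1}a_{si}\,|0\cdots 0\,i\,0\cdots 0\rangle+\sqrt{1-p}\,|0\cdots0\rangle ,\qquad 0\le p\le 1,\quad \sum_{s=1}^{n}\sum_{i=1}^{d-1}|a_{si}|^2=1,$$ where in the term with coefficient $a_{si}$ the entry $i$ stands at position $s$. For a bipartite pure state $|\phi\rangle_{AB}$ with reduced state $\rho_A$ let $T_q(|\phi\rangle_{AB})=\frac{1}{q-1}\bigl(1-\operatorname{tr}\rho_A^q\bigr)$ for $q>0$, $q\ne1$, and $T_1(|\phi\rangle_{AB})=-\operatorname{tr}\rho_A\ln\rho_A$ (the limit $q\to1$). For a bipartite mixed state $\rho_{AB}$ let $$T_q^a(\rho_{AB})=\max_{\{p_i,|\psi_i\rangle\}}\sum_i p_i\,T_q(|\psi_i\rangle)$$ be the Tsallis-$q$ entanglement of assistance, the maximum being over all pure state decompositions $\rho_{AB}=\sum_i p_i|\psi_i\rangle\langle\psi_i|$.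 Let $r\ge1$ and let $P,P_0,\dots,P_{r-1}$ be non-empty, pairwise disjoint sets of qudits among $A_1,\dots,A_n$ (they need not exhaust $A_1,\dots,A_n$). Let $\rho_{P|P_0\cdots P_{r-1}}$ be the reduced density matrix of $|\psi\rangle$ on $P\cup P_0\cup\dots\cup P_{r-1}$, viewed as a bipartite state of $P$ and $P_0\cup\dots\cup P_{r-1}$, and let $\rho_{PP_j}$ be the reduced density matrix on $P\cup P_j$, viewed as a bipartite state of $P$ and $P_j$. Let $q\in\bigl[\tfrac{5-\sqrt{13}}2,2\bigr]\cup\bigl[3,\tfrac{5+\sqrt{13}}2\bigr]$, $\mu\in(0,1]$, $0<k\le1$, and suppose that $$k\,T_q^a(\rho_{PP_l})\ \ge\ \sum_{j=l+1}^{r-1}T_q^a(\rho_{PP_j})\qquad\text{for } l=0,1,\dots,r-2 .$$ Then $$\bigl[T_q^a(\rho_{P|P_0\cdots P_{r-1}})\bigr]^\mu\ \le\ \sum_{j=0}^{r-1}\mathcal K_\mu^{\,j}\,\bigl[T_q^a(\rho_{PP_j})\bigr]^\mu,\qquad \mathcal K_\mu=\frac{(1+k)^\mu-1}{k^\mu}.$$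 -/

import Mathlib

open scoped BigOperators

/-! ### Tsallis entropy, bipartite Tsallis-`q` entanglement and its assisted version -/

/-- The Tsallis-`q` entropy `S_q(ρ) = (1 - tr ρ ^ q) / (q - 1)` of a density matrix; at `q = 1`
it is the limit `-tr (ρ log ρ)`, the von Neumann entropy. Functions of the Hermitian matrix `ρ`
are given by the continuous functional calculus (i.e. they act on the eigenvalues). -/
noncomputable def tsallisEntropy {α : Type*} [Fintype α] [DecidableEq α]
    (q : ℝ) (ρ : Matrix α α ℂ) : ℝ :=
  if q = 1 then (cfc Real.negMulLog ρ).trace.re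
  else (1 - (cfc (fun x : ℝ => x ^ q) ρ).trace.re) / (q - 1)

/-- The rank-one operator `|ψ⟩⟨ψ|`. -/
def ketBra {ι : Type*} (ψ : ι → ℂ) : Matrix ι ι ℂ :=
  Matrix.of fun x y => ψ x * star (ψ y)

/-- The partial trace over the second factor. -/
def partialTraceRight {α β : Type*} [Fintype β] (M : Matrix (α × β) (α × β) ℂ) :
    Matrix α α ℂ :=
  Matrix.of fun x y => ∑ z, M (x, z) (y, z)

/-- `ψ` is a unit vector of `ℂ^ι`. -/
def IsUnitVector {ι : Type*} [Fintype ι] (ψ : ι → ℂ) : Prop :=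
  ∑ x, ‖ψ x‖ ^ 2 = 1

/-- The Tsallis-`q` entanglement `T_q(|ψ⟩_{AB}) = S_q(ρ_A)` of a bipartite pure state. -/
noncomputable def pureTsallisEntanglement {α β : Type*} [Fintype α] [DecidableEq α] [Fintype β]
    (q : ℝ) (ψ : α × β → ℂ) : ℝ :=
  tsallisEntropy q (partialTraceRight (ketBra ψ))

/-- `{p_i, |ψ_i⟩}` is a pure state decomposition `ρ = ∑ i, p_i |ψ_i⟩⟨ψ_i|` of the state `ρ`. -/
structure IsPureDecomposition {ι : Type*} [Fintype ι] (ρ : Matrix ι ι ℂ)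
    {N : ℕ} (p : Fin N → ℝ) (ψ : Fin N → ι → ℂ) : Prop where
  nonneg : ∀ i, 0 ≤ p i
  sum_eq_one : ∑ i, p i = 1
  unit : ∀ i, IsUnitVector (ψ i)
  eq_sum : ρ = ∑ i, (p i : ℂ) • ketBra (ψ i)

/-- The Tsallis-`q` entanglement of assistance `T_q^a(ρ_{AB})`: the largest average Tsallis-`q`
entanglement over all (finite) pure state decompositions of `ρ_{AB}`. -/
noncomputable def tsallisAssistance {α β : Type*} [Fintype α] [DecidableEq α] [Fintype β]
    (q : ℝ) (ρ : Matrix (α × β) (α × β) ℂ) : ℝ :=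
  sSup {t : ℝ | ∃ (N : ℕ) (p : Fin N → ℝ) (ψ : Fin N → α × β → ℂ),
    IsPureDecomposition ρ p ψ ∧ t = ∑ i, p i * pureTsallisEntanglement q (ψ i)}

/-! ### Systems of `n` qudits -/

/-- The computational basis vector `|x_1 ⋯ x_n⟩`. -/
def ket {n d : ℕ} (x : Fin n → Fin d) : (Fin n → Fin d) → ℂ :=
  Pi.single x 1

/-- The vector `∑ s, ∑ i ∈ {1, …, d - 1}, a s i |0 ⋯ i ⋯ 0⟩`, with `i` at position `s`.
It is an `n`-qudit generalized `W`-class state if the coefficients are normalized. -/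
def wVector {n d : ℕ} [NeZero d] (a : Fin n → Fin d → ℂ) : (Fin n → Fin d) → ℂ :=
  ∑ s, ∑ i ∈ Finset.univ.filter (fun i : Fin d => i ≠ 0), a s i • ket (Pi.single s i)

/-- `ψ` is a GWV state: `ψ = √p |W⟩ + √(1 - p) |0 ⋯ 0⟩` with `0 ≤ p ≤ 1` and `|W⟩` an
`n`-qudit generalized `W`-class state. -/
def IsGWV {n d : ℕ} [NeZero d] (ψ : (Fin n → Fin d) → ℂ) : Prop :=
  ∃ (p : ℝ) (a : Fin n → Fin d → ℂ), 0 ≤ p ∧ p ≤ 1 ∧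
    ∑ s, ∑ i ∈ Finset.univ.filter (fun i : Fin d => i ≠ 0), ‖a s i‖ ^ 2 = 1 ∧
    ψ = (Real.sqrt p : ℂ) • wVector a + (Real.sqrt (1 - p) : ℂ) • ket 0

/-- The configuration of `n` qudits that is `x` on `A`, `y` on `B` and `z` on all other qudits
(for disjoint `A` and `B`). -/
def glue {n d : ℕ} (A B : Finset (Fin n)) (x : A → Fin d) (y : B → Fin d)
    (z : {i : Fin n // i ∉ A ∧ i ∉ B} → Fin d) : Fin n → Fin d := fun i =>
  if hA : i ∈ A then x ⟨i, hA⟩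
  else if hB : i ∈ B then y ⟨i, hB⟩
  else z ⟨i, hA, hB⟩

/-- The reduced density matrix `ρ_{A|B}` of the `n`-qudit pure state `ψ` on the qudits in
`A ∪ B`, for disjoint `A` and `B`, regarded as a bipartite state of `A` and `B`: the partial
trace of `|ψ⟩⟨ψ|` over all other qudits. -/
def reducedState {n d : ℕ} (ψ : (Fin n → Fin d) → ℂ) (A B : Finset (Fin n)) :
    Matrix ((A → Fin d) × (B → Fin d)) ((A → Fin d) × (B → Fin d)) ℂ :=
  partialTraceRight (ketBra fun w : ((A → Fin d) × (B → Fin d)) ×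
    ({i : Fin n // i ∉ A ∧ i ∉ B} → Fin d) => ψ (glue A B w.1.1 w.1.2 w.2))

/-! A GWV state has at most one excited qudit. So every pure state of positive weight in a
decomposition of a reduced state is a combination of vectors `|u 0⟩` and `|0 v⟩`. Its reduction to
the first party has nonzero eigenvalues among `x`, `1 - x`, where `x (1 - x) = A B` is the product
of the weights on `u ≠ 0` and `v ≠ 0`. Its entanglement is therefore `g (A B)` with `g = detTsallis
q`, which vanishes at `0` and is concave and increasing when `0 < q ≤ 2` or `3 ≤ q`.

Polygamy for `μ = 1` (`IsSingleExcitation.tsallisAssistance_le_sum`): measure the qudits outside `P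
∪ P_j` on each member of a decomposition. Outcome `0` keeps `A`, shrinks `B` to `b_j`, and
contributes at least `(b_j / B) g (A B)` by `div_mul_detTsallis_le`. A single excitation lies in
some `P_j`, so `∑ b_j ≥ B` and these contributions add up to at least `g (A B)`.

The power `μ` and the constants `K_μ ^ j` come from an inequality for real numbers,
`rpow_sum_le_sum_pow_mul_rpow`, a consequence of the concavity of `t ↦ t ^ μ`. -/

/-! ### Concavity of the binary Tsallis entropy in the determinant. -/

/-- Composing with `m ↦ √(1 - 4m)`: if `φ'` vanishes at `0` and `φ''` is nonnegative and monotone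
on `[0, 1)`, then `m ↦ -φ(√(1 - 4m))` is concave and monotone. -/
theorem concaveOn_monotoneOn_neg_comp_sqrt {φ φ₁ φ₂ : ℝ → ℝ}
    (hc : ContinuousOn φ (Set.Icc 0 1))
    (h1 : ∀ s ∈ Set.Ioo (0 : ℝ) 1, HasDerivAt φ (φ₁ s) s)
    (h2 : ∀ s ∈ Set.Ico (0 : ℝ) 1, HasDerivAt φ₁ (φ₂ s) s)
    (h0 : φ₁ 0 = 0) (hn : ∀ s ∈ Set.Ico (0 : ℝ) 1, 0 ≤ φ₂ s)
    (hm : MonotoneOn φ₂ (Set.Ico 0 1)) :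
    ConcaveOn ℝ (Set.Icc 0 (1 / 4)) (fun m : ℝ => -φ (√(1 - 4 * m))) ∧
      MonotoneOn (fun m : ℝ => -φ (√(1 - 4 * m))) (Set.Icc 0 (1 / 4)) := by
  have hsub : interior (Set.Ico (0 : ℝ) 1) ⊆ Set.Ico 0 1 := interior_subset
  have hc1 : ContinuousOn φ₁ (Set.Ico 0 1) := fun s hs =>
    (h2 s hs).continuousAt.continuousWithinAt
  have hconv : ConvexOn ℝ (Set.Ico (0 : ℝ) 1) φ₁ := by
    apply MonotoneOn.convexOn_of_deriv (convex_Ico 0 1) hc1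
    · exact fun s hs => (h2 s (hsub hs)).differentiableAt.differentiableWithinAt
    · intro s hs t ht hst
      rw [(h2 s (hsub hs)).deriv, (h2 t (hsub ht)).deriv]
      exact hm (hsub hs) (hsub ht) hst
  have hmono : MonotoneOn φ₁ (Set.Ico (0 : ℝ) 1) := by
    apply monotoneOn_of_deriv_nonneg (convex_Ico 0 1) hc1
    · exact fun s hs => (h2 s (hsub hs)).differentiableAt.differentiableWithinAt
    · intro s hs
      rw [(h2 s (hsub hs)).deriv]
      exact hn s (hsub hs)
  -- The derivative in `m` is `2 φ₁ s / s` at `s = √(1 - 4m)`. Convexity of `φ₁` with `φ₁ 0 = 0`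
  -- makes this slope increase in `s`, hence decrease in `m`.
  have hstar : ∀ s t : ℝ, 0 < s → s ≤ t → t < 1 → φ₁ s / s ≤ φ₁ t / t := by
    intro s t hs hst ht
    have ht0 : 0 < t := hs.trans_le hst
    have hst1 : s / t ≤ 1 := (div_le_one ht0).2 hst
    have := hconv.2 (⟨le_rfl, one_pos⟩ : (0 : ℝ) ∈ Set.Ico 0 1) (⟨ht0.le, ht⟩ : t ∈ Set.Ico 0 1)
      (by linarith : 0 ≤ 1 - s / t) (by positivity : 0 ≤ s / t) (by ring)
    simp only [smul_eq_mul, mul_zero, zero_add, h0, div_mul_cancel₀ _ ht0.ne'] at this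
    rw [div_le_div_iff₀ hs ht0]
    have h3 := mul_le_mul_of_nonneg_right this ht0.le
    have h4 : s / t * φ₁ t * t = φ₁ t * s := by field_simp
    linarith
  have hr : ∀ m ∈ Set.Icc (0 : ℝ) (1 / 4), √(1 - 4 * m) ∈ Set.Icc (0 : ℝ) 1 := fun m hm' =>
    ⟨Real.sqrt_nonneg _, Real.sqrt_le_one.2 (by linarith [hm'.1])⟩
  have hro : ∀ m ∈ Set.Ioo (0 : ℝ) (1 / 4), √(1 - 4 * m) ∈ Set.Ioo (0 : ℝ) 1 := fun m hm' =>
    ⟨Real.sqrt_pos.2 (by linarith [hm'.2]),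
      (Real.sqrt_lt' one_pos).2 (by linarith [hm'.1])⟩
  have hcont : ContinuousOn (fun m : ℝ => -φ (√(1 - 4 * m))) (Set.Icc 0 (1 / 4)) :=
    (hc.comp (by fun_prop) hr).neg
  have hd : ∀ m ∈ Set.Ioo (0 : ℝ) (1 / 4), HasDerivAt (fun m : ℝ => -φ (√(1 - 4 * m)))
      (2 * (φ₁ (√(1 - 4 * m)) / √(1 - 4 * m))) m := by
    intro m hm'
    have hpos : 0 < √(1 - 4 * m) := (hro m hm').1
    have e1 : HasDerivAt (fun m : ℝ => 1 - 4 * m) (-4) m := by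
      simpa using ((hasDerivAt_id m).const_mul 4).const_sub 1
    have e2 := e1.sqrt (by linarith [hm'.2])
    have e3 := ((h1 _ (hro m hm')).comp m e2).neg
    refine e3.congr_deriv ?_
    field_simp
    ring
  have hint : interior (Set.Icc (0 : ℝ) (1 / 4)) = Set.Ioo 0 (1 / 4) := interior_Icc
  constructor
  · apply AntitoneOn.concaveOn_of_deriv (convex_Icc _ _) hcont
    · rw [hint]
      exact fun m hm' => (hd m hm').differentiableAt.differentiableWithinAt
    · rw [hint]
      intro m hm' m' hm'' hle
      rw [(hd m hm').deriv, (hd m' hm'').deriv]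
      have := hstar _ _ (hro m' hm'').1 (Real.sqrt_le_sqrt (by linarith : 1 - 4 * m' ≤ 1 - 4 * m))
        (hro m hm').2
      linarith
  · apply monotoneOn_of_deriv_nonneg (convex_Icc _ _) hcont
    · rw [hint]
      exact fun m hm' => (hd m hm').differentiableAt.differentiableWithinAt
    · rw [hint]
      intro m hm'
      rw [(hd m hm').deriv]
      have hs := hro m hm'
      have := hmono (a := 0) (b := √(1 - 4 * m)) ⟨le_rfl, one_pos⟩ ⟨hs.1.le, hs.2⟩ hs.1.le
      rw [h0] at this
      have := hs.1
      positivity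

/-- The Tsallis-`q` entropy of the distribution `(x, 1 - x)`. -/
noncomputable def binTsallis (q x : ℝ) : ℝ :=
  if q = 1 then Real.negMulLog x + Real.negMulLog (1 - x)
  else (1 - (x ^ q + (1 - x) ^ q)) / (q - 1)

/-- The Tsallis-`q` entropy of a spectrum `{x, 1 - x}` as a function of `m = x (1 - x)`. -/
noncomputable def detTsallis (q m : ℝ) : ℝ :=
  binTsallis q ((1 - √(1 - 4 * m)) / 2)

/-- The derivative is `r / 2` times a difference of `(r - 1)`-th powers; the two factors have the
same sign exactly when the exponent avoids `(0, 1)`. -/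
theorem monotoneOn_rpow_add_rpow {r : ℝ} (hr : r ≤ 0 ∨ 1 ≤ r) :
    MonotoneOn (fun s : ℝ => ((1 + s) / 2) ^ r + ((1 - s) / 2) ^ r) (Set.Ico 0 1) := by
  have hd : ∀ s ∈ Set.Ico (0 : ℝ) 1,
      HasDerivAt (fun s : ℝ => ((1 + s) / 2) ^ r + ((1 - s) / 2) ^ r)
        (r / 2 * (((1 + s) / 2) ^ (r - 1) - ((1 - s) / 2) ^ (r - 1))) s := by
    intro s hs
    have e1 : HasDerivAt (fun s : ℝ => (1 + s) / 2) (1 / 2) s :=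
      ((hasDerivAt_id s).const_add 1).div_const 2
    have e2 : HasDerivAt (fun s : ℝ => (1 - s) / 2) (-1 / 2) s :=
      ((hasDerivAt_id s).const_sub 1).div_const 2
    refine ((e1.rpow_const (p := r) (Or.inl (by linarith [hs.1] : (1 + s) / 2 ≠ 0) )).add
      (e2.rpow_const (p := r) (Or.inl ?_))).congr_deriv ?_
    · linarith [hs.2]
    · ring
  apply monotoneOn_of_deriv_nonneg (convex_Ico 0 1)
  · exact fun s hs => (hd s hs).continuousAt.continuousWithinAt
  · exact fun s hs => (hd s (interior_subset hs)).differentiableAt.differentiableWithinAt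
  · intro s hs
    have hs' := interior_subset hs
    rw [(hd s hs').deriv]
    have ha : 0 < (1 - s) / 2 := by linarith [hs'.2]
    have hb : (1 - s) / 2 ≤ (1 + s) / 2 := by linarith [hs'.1]
    rcases hr with hr | hr
    · have := Real.rpow_le_rpow_of_nonpos ha hb (by linarith : r - 1 ≤ 0)
      exact mul_nonneg_of_nonpos_of_nonpos (by linarith) (by linarith)
    · have := Real.rpow_le_rpow ha.le hb (by linarith : 0 ≤ r - 1)
      exact mul_nonneg (by linarith) (by linarith)

/-- With `s = √(1 - 4m)` the spectrum is `(1 ± s) / 2`. The factor `q - 1` cancels in the second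
derivative, so one formula for `φ₂` serves `q = 1` too. Its monotonicity needs `q - 2 ∉ (0, 1)`,
which is where the gap between `2` and `3` comes from. -/
theorem concaveOn_monotoneOn_detTsallis {q : ℝ} (hq0 : 0 < q) (hq : q ≤ 2 ∨ 3 ≤ q) :
    ConcaveOn ℝ (Set.Icc 0 (1 / 4)) (detTsallis q) ∧
      MonotoneOn (detTsallis q) (Set.Icc 0 (1 / 4)) := by
  have e1 : ∀ s : ℝ, HasDerivAt (fun s : ℝ => (1 + s) / 2) (1 / 2) s := fun s =>
    ((hasDerivAt_id s).const_add 1).div_const 2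
  have e2 : ∀ s : ℝ, HasDerivAt (fun s : ℝ => (1 - s) / 2) (-1 / 2) s := fun s =>
    ((hasDerivAt_id s).const_sub 1).div_const 2
  have hn : ∀ s ∈ Set.Ico (0 : ℝ) 1,
      0 ≤ q / 4 * (((1 + s) / 2) ^ (q - 2) + ((1 - s) / 2) ^ (q - 2)) := by
    intro s hs
    have h1 : 0 < (1 + s) / 2 := by linarith [hs.1]
    have h2 : 0 < (1 - s) / 2 := by linarith [hs.2]
    positivity
  have hm : MonotoneOn (fun s : ℝ => q / 4 * (((1 + s) / 2) ^ (q - 2) + ((1 - s) / 2) ^ (q - 2)))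
      (Set.Ico 0 1) := by
    have h : q - 2 ≤ 0 ∨ 1 ≤ q - 2 := by rcases hq with h | h <;> [left; right] <;> linarith
    intro s hs t ht hst
    exact mul_le_mul_of_nonneg_left (monotoneOn_rpow_add_rpow h hs ht hst) (by positivity)
  have hx : ∀ s : ℝ, 1 - (1 - s) / 2 = (1 + s) / 2 := fun s => by ring
  by_cases h1 : q = 1
  · subst h1
    have key := concaveOn_monotoneOn_neg_comp_sqrt
      (φ := fun s => -(Real.negMulLog ((1 - s) / 2) + Real.negMulLog ((1 + s) / 2)))
      (φ₁ := fun s => 1 / 2 * (Real.log ((1 + s) / 2) - Real.log ((1 - s) / 2)))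
      (φ₂ := fun s : ℝ => (1 : ℝ) / 4 *
        (((1 + s) / 2) ^ ((1 : ℝ) - 2) + ((1 - s) / 2) ^ ((1 : ℝ) - 2)))
      (by fun_prop) ?_ ?_ (by simp) hn hm
    · have e : (fun m : ℝ => -(fun s => -(Real.negMulLog ((1 - s) / 2) +
          Real.negMulLog ((1 + s) / 2))) (√(1 - 4 * m))) = detTsallis 1 := by
        funext m
        simp [detTsallis, binTsallis, hx]
      rwa [e] at key
    · intro s hs
      have p1 : (1 + s) / 2 ≠ 0 := by linarith [hs.1]
      have p2 : (1 - s) / 2 ≠ 0 := by linarith [hs.2]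
      refine ((((Real.hasDerivAt_negMulLog p2).comp s (e2 s)).add
        ((Real.hasDerivAt_negMulLog p1).comp s (e1 s))).neg).congr_deriv ?_
      ring
    · intro s hs
      have p1 : 0 < (1 + s) / 2 := by linarith [hs.1]
      have p2 : 0 < (1 - s) / 2 := by linarith [hs.2]
      refine ((((e1 s).log p1.ne').sub ((e2 s).log p2.ne')).const_mul (1 / 2)).congr_deriv ?_
      rw [show (1 : ℝ) - 2 = -1 by norm_num, Real.rpow_neg_one, Real.rpow_neg_one]
      ring
  · have hq1 : q - 1 ≠ 0 := sub_ne_zero.2 h1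
    have key := concaveOn_monotoneOn_neg_comp_sqrt
      (φ := fun s => -((1 - (((1 - s) / 2) ^ q + ((1 + s) / 2) ^ q)) / (q - 1)))
      (φ₁ := fun s => q / (q - 1) / 2 * (((1 + s) / 2) ^ (q - 1) - ((1 - s) / 2) ^ (q - 1)))
      (φ₂ := fun s : ℝ => q / 4 * (((1 + s) / 2) ^ (q - 2) + ((1 - s) / 2) ^ (q - 2)))
      ?_ ?_ ?_ (by simp) hn hm
    · have e : (fun m : ℝ => -(fun s => -((1 - (((1 - s) / 2) ^ q + ((1 + s) / 2) ^ q)) / (q - 1)))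
          (√(1 - 4 * m))) = detTsallis q := by
        funext m
        simp [detTsallis, binTsallis, hx, h1]
      rwa [e] at key
    · have c1 : Continuous fun s : ℝ => ((1 - s) / 2) ^ q :=
        (Real.continuous_rpow_const hq0.le).comp (by fun_prop)
      have c2 : Continuous fun s : ℝ => ((1 + s) / 2) ^ q :=
        (Real.continuous_rpow_const hq0.le).comp (by fun_prop)
      exact (((continuous_const.sub (c1.add c2)).div_const _).neg).continuousOn
    · intro s hs
      have p1 : (1 + s) / 2 ≠ 0 := by linarith [hs.1]
      have p2 : (1 - s) / 2 ≠ 0 := by linarith [hs.2]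
      refine ((((((e2 s).rpow_const (p := q) (Or.inl p2)).add
        ((e1 s).rpow_const (p := q) (Or.inl p1))).const_sub 1).div_const (q - 1)).neg).congr_deriv ?_
      ring
    · intro s hs
      have p1 : (1 + s) / 2 ≠ 0 := by linarith [hs.1]
      have p2 : (1 - s) / 2 ≠ 0 := by linarith [hs.2]
      refine ((((e1 s).rpow_const (p := q - 1) (Or.inl p1)).sub
        ((e2 s).rpow_const (p := q - 1) (Or.inl p2))).const_mul (q / (q - 1) / 2)).congr_deriv ?_
      rw [show q - 1 - 1 = q - 2 by ring]
      field_simp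
      ring

theorem detTsallis_zero {q : ℝ} (hq : 0 < q) : detTsallis q 0 = 0 := by
  simp [detTsallis, binTsallis, Real.zero_rpow hq.ne']

theorem detTsallis_nonneg {q m : ℝ} (hq0 : 0 < q) (hq : q ≤ 2 ∨ 3 ≤ q)
    (hm : m ∈ Set.Icc (0 : ℝ) (1 / 4)) : 0 ≤ detTsallis q m := by
  rw [← detTsallis_zero hq0]
  exact (concaveOn_monotoneOn_detTsallis hq0 hq).2 ⟨le_rfl, by norm_num⟩ hm hm.1

theorem mul_le_one_div_four {A B : ℝ} (hA : 0 ≤ A) (hB : 0 ≤ B) (h : A + B ≤ 1) :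
    A * B ∈ Set.Icc (0 : ℝ) (1 / 4) :=
  ⟨by positivity, by nlinarith [sq_nonneg (A - B)]⟩

/-- Shrinking the weight `B` of one party to `b` keeps at least the fraction `b / B` of the
entanglement. -/
theorem div_mul_detTsallis_le {q A B b w : ℝ} (hq0 : 0 < q) (hq : q ≤ 2 ∨ 3 ≤ q)
    (hA : 0 ≤ A) (hw : 0 ≤ w) (hb : 0 ≤ b) (hbB : b ≤ B) (h1 : A + B + w = 1) :
    b / B * detTsallis q (A * B) ≤
      (A + b + w) * detTsallis q (A * b / (A + b + w) ^ 2) := by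
  obtain ⟨hconc, hmono⟩ := concaveOn_monotoneOn_detTsallis hq0 hq
  have hM : A * B ∈ Set.Icc (0 : ℝ) (1 / 4) := mul_le_one_div_four hA (hb.trans hbB) (by linarith)
  have hn0 : 0 ≤ A + b + w := by positivity
  have hm : A * b / (A + b + w) ^ 2 ∈ Set.Icc (0 : ℝ) (1 / 4) := by
    rcases hn0.eq_or_lt with h | h
    · rw [← h]; norm_num
    · have e : A * b / (A + b + w) ^ 2 = A / (A + b + w) * (b / (A + b + w)) := by field_simp
      rw [e]
      refine mul_le_one_div_four (by positivity) (by positivity) ?_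
      rw [← add_div, div_le_one h]
      linarith
  have hgM := detTsallis_nonneg hq0 hq hM
  have hgm := detTsallis_nonneg hq0 hq hm
  rcases hb.eq_or_lt with h | hb'
  · subst h
    simp only [zero_div, zero_mul]
    positivity
  have hB' : 0 < B := hb'.trans_le hbB
  have hn : 0 < A + b + w := by positivity
  have hn1 : A + b + w ≤ 1 := by linarith
  -- As `A + w = 1 - B`, this amounts to `(B - b) (1 - B) ≥ 0`.
  have hfrac : b / B ≤ A + b + w := by
    rw [div_le_iff₀ hB']
    nlinarith
  -- If the determinant does not drop, monotonicity suffices. Otherwise it drops by a factor `t`,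
  -- and concavity through `0` costs at most that factor, while `(A + b + w) * t = (b / B) / (A + b
  -- + w) ≥ b / B`.
  rcases le_total (A * B) (A * b / (A + b + w) ^ 2) with hle | hle
  · exact mul_le_mul hfrac (hmono hM hm hle) hgM hn0
  · rcases hA.eq_or_lt with h | hA'
    · subst h
      simp only [zero_mul, zero_div, detTsallis_zero hq0, mul_zero]
      exact le_rfl
    have hM0 : 0 < A * B := by positivity
    set t := A * b / (A + b + w) ^ 2 / (A * B) with ht
    have ht0 : 0 ≤ t := by positivity
    have ht1 : t ≤ 1 := (div_le_one hM0).2 hle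
    have hc := hconc.2 (⟨le_rfl, by norm_num⟩ : (0 : ℝ) ∈ Set.Icc 0 (1 / 4)) hM
      (by linarith : 0 ≤ 1 - t) ht0 (by ring)
    simp only [smul_eq_mul, mul_zero, zero_add, detTsallis_zero hq0] at hc
    rw [ht, div_mul_cancel₀ _ hM0.ne', ← ht] at hc
    have htn : b / B ≤ (A + b + w) * t := by
      have e : (A + b + w) * t = b / B / (A + b + w) := by
        rw [ht]; field_simp
      rw [e, le_div_iff₀ hn]
      exact mul_le_of_le_one_right (by positivity) hn1
    calc b / B * detTsallis q (A * B) ≤ (A + b + w) * t * detTsallis q (A * B) :=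
          mul_le_mul_of_nonneg_right htn hgM
      _ = (A + b + w) * (t * detTsallis q (A * B)) := by ring
      _ ≤ _ := mul_le_mul_of_nonneg_left hc hn0

/-! ### The weighted power inequality for real numbers. -/

/-- With `x = R / k ≤ t` the last term equals `(x + R) ^ μ - x ^ μ`, and increments of a concave
function over steps of equal length `R` decrease. -/
theorem rpow_add_le_rpow_add_mul_rpow {t R k μ : ℝ} (hR0 : 0 ≤ R) (hk : 0 < k)
    (hRt : R ≤ k * t) (hμ0 : 0 < μ) (hμ1 : μ ≤ 1) :
    (t + R) ^ μ ≤ t ^ μ + ((1 + k) ^ μ - 1) / k ^ μ * R ^ μ := by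
  have ht0 : 0 ≤ t := by
    by_contra h
    nlinarith [mul_pos hk (by linarith : 0 < -t)]
  rcases hR0.eq_or_lt with h | hR
  · simp [← h, Real.zero_rpow hμ0.ne']
  have hkμ : 0 < k ^ μ := Real.rpow_pos_of_pos hk μ
  set x := R / k with hx
  have hx0 : 0 < x := by positivity
  have hRx : R = k * x := by rw [hx]; field_simp
  have hxt : x ≤ t := by rw [hx, div_le_iff₀ hk]; linarith
  have e1 : ((1 + k) ^ μ - 1) / k ^ μ * R ^ μ = (x + R) ^ μ - x ^ μ := by
    rw [show x + R = (1 + k) * x by rw [hRx]; ring, hRx, Real.mul_rpow hk.le hx0.le,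
      Real.mul_rpow (by positivity) hx0.le]
    field_simp
  rw [e1]
  have hc := Real.concaveOn_rpow hμ0.le hμ1
  have hD : 0 < t + R - x := by linarith
  have m1 : x ∈ Set.Ici (0 : ℝ) := hx0.le
  have m2 : t + R ∈ Set.Ici (0 : ℝ) := by simp only [Set.mem_Ici]; positivity
  -- The points `t` and `x + R` are the convex combinations of `x` and `t + R` with weights `τ` and
  -- `1 - τ` interchanged; the two concavity inequalities are added.
  set τ := R / (t + R - x) with hτ
  have hτ0 : 0 ≤ τ := by positivity
  have hτ1 : τ ≤ 1 := by rw [hτ, div_le_one hD]; linarith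
  have hτD : τ * (t + R - x) = R := by rw [hτ]; field_simp
  have c1 := hc.2 m1 m2 hτ0 (by linarith : 0 ≤ 1 - τ) (by ring)
  have c2 := hc.2 m1 m2 (by linarith : 0 ≤ 1 - τ) hτ0 (by ring)
  simp only [smul_eq_mul] at c1 c2
  rw [show τ * x + (1 - τ) * (t + R) = t by linarith] at c1
  rw [show (1 - τ) * x + τ * (t + R) = x + R by linarith] at c2
  linarith

theorem rpow_sum_le_sum_pow_mul_rpow {k μ : ℝ} (hk : 0 < k) (hμ0 : 0 < μ) (hμ1 : μ ≤ 1)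
    {r : ℕ} (t : Fin r → ℝ) (ht : ∀ j, 0 ≤ t j)
    (hcond : ∀ l : Fin r, (l : ℕ) + 1 < r → ∑ j ∈ Finset.Ioi l, t j ≤ k * t l) :
    (∑ j, t j) ^ μ ≤ ∑ j : Fin r, (((1 + k) ^ μ - 1) / k ^ μ) ^ (j : ℕ) * t j ^ μ := by
  have hK : 0 ≤ ((1 + k) ^ μ - 1) / k ^ μ :=
    div_nonneg (sub_nonneg.2 (Real.one_le_rpow (by linarith) hμ0.le)) (by positivity)
  induction r with
  | zero => simp [Real.zero_rpow hμ0.ne']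
  | succ r ih =>
    have hR0 : 0 ≤ ∑ j : Fin r, t j.succ := Finset.sum_nonneg fun j _ => ht _
    have hR : ∑ j : Fin r, t j.succ ≤ k * t 0 := by
      -- For the last index `hcond` says nothing, but the tail is empty and `0 ≤ t 0` is enough.
      rcases Nat.eq_zero_or_pos r with h | h
      · subst h
        simpa using mul_nonneg hk.le (ht 0)
      · simpa [Fin.Ioi_zero_eq_map] using hcond 0 (by simpa using h)
    have hi := ih (fun j => t j.succ) (fun j => ht _) (by
      intro l hl
      have := hcond l.succ (by simpa using hl)
      simpa [← Fin.map_succEmb_Ioi] using this)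
    rw [Fin.sum_univ_succ, Fin.sum_univ_succ]
    refine (rpow_add_le_rpow_add_mul_rpow hR0 hk hR hμ0 hμ1).trans ?_
    simp only [Fin.val_zero, pow_zero, one_mul, Fin.val_succ, pow_succ']
    rw [add_le_add_iff_left]
    refine (mul_le_mul_of_nonneg_left hi hK).trans (le_of_eq ?_)
    rw [Finset.mul_sum]
    exact Finset.sum_congr rfl fun j _ => by ring

/-! ### Spectra of rank-two density matrices. -/

/-- If `R` is Hermitian with `R³ = R² - mR`, `tr R = 1` and `tr R² = 1 - 2m`, then its nonzero
eigenvalues are `x` and `1 - x` with `x (1 - x) = m`. -/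
theorem trace_cfc_of_pow_three_eq {α : Type*} [Fintype α] [DecidableEq α] {R : Matrix α α ℂ}
    (hR : R.IsHermitian) {m x : ℝ} (hx : x * (1 - x) = m) (h3 : R ^ 3 = R ^ 2 - m • R)
    (h1 : R.trace = 1) (h2 : (R ^ 2).trace = ((1 - 2 * m : ℝ) : ℂ)) {f : ℝ → ℝ} (hf : f 0 = 0) :
    (cfc f R).trace.re = f x + f (1 - x) := by
  have hsa : IsSelfAdjoint R := hR
  have hspec : ∀ t ∈ spectrum ℝ R, t = 0 ∨ t = x ∨ t = 1 - x := by
    intro t ht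
    have h0 : cfc (fun t : ℝ => t ^ 3 - (t ^ 2 - m * t)) R = cfc (fun _ : ℝ => (0 : ℝ)) R := by
      rw [cfc_sub (fun t : ℝ => t ^ 3) (fun t : ℝ => t ^ 2 - m * t),
        cfc_sub (fun t : ℝ => t ^ 2) (fun t : ℝ => m * t), cfc_pow_id R 3, cfc_pow_id R 2,
        cfc_const_mul_id m R, cfc_const_zero, h3, sub_self]
    have := (cfc_eq_cfc_iff_eqOn (a := R)).1 h0 ht
    have e : t * ((t - x) * (t - (1 - x))) = 0 := by
      linear_combination this + t * hx
    rcases mul_eq_zero.1 e with h | h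
    · exact Or.inl h
    rcases mul_eq_zero.1 h with h | h
    · exact Or.inr (Or.inl (by linarith))
    · exact Or.inr (Or.inr (by linarith))
  -- Since `f 0 = 0`, interpolation at `x` and `1 - x` replaces `f` on the spectrum by `c t + e t²`,
  -- so only `tr R` and `tr R²` are needed. Nodes that coincide or equal `0` are treated apart.
  obtain ⟨c, e, hcx, hcy⟩ : ∃ c e : ℝ, f x = c * x + e * x ^ 2 ∧
      f (1 - x) = c * (1 - x) + e * (1 - x) ^ 2 := by
    by_cases hx0 : x = 0
    · exact ⟨f 1, 0, by simp [hx0, hf], by simp [hx0]⟩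
    by_cases hx1 : 1 - x = 0
    · have : x = 1 := by linarith
      exact ⟨f 1, 0, by simp [this], by simp [this, hf]⟩
    by_cases hxx : 1 - x = x
    · exact ⟨f x / x, 0, by field_simp; ring, by rw [hxx]; field_simp; ring⟩
    · have hd : 1 - x - x ≠ 0 := sub_ne_zero.2 hxx
      refine ⟨f x / x - (f (1 - x) / (1 - x) - f x / x) / (1 - x - x) * x,
        (f (1 - x) / (1 - x) - f x / x) / (1 - x - x), ?_, ?_⟩
      · field_simp
        ring
      · field_simp
        ring
  have hcfc : cfc f R = c • R + e • R ^ 2 := by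
    rw [cfc_congr (g := fun t => c * t + e * t ^ 2) (a := R), cfc_add R (fun t => c * t)
      (fun t => e * t ^ 2), cfc_const_mul_id c R, cfc_const_mul e (fun t => t ^ 2) R,
      cfc_pow_id R 2]
    intro t ht
    rcases hspec t ht with h | h | h
    · simp [h, hf]
    · simp only [h, hcx]
    · simp only [h, hcy]
  rw [hcfc, Matrix.trace_add, Matrix.trace_smul, Matrix.trace_smul, h1, h2, hcx, hcy]
  simp only [Complex.add_re, Complex.smul_re, Complex.one_re, Complex.ofReal_re, smul_eq_mul]
  linear_combination (2 * e) * hx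

theorem tsallisEntropy_eq_detTsallis {α : Type*} [Fintype α] [DecidableEq α] {R : Matrix α α ℂ}
    {q : ℝ} (hq : 0 < q) (hR : R.IsHermitian) {m : ℝ} (hm : m ≤ 1 / 4)
    (h3 : R ^ 3 = R ^ 2 - m • R) (h1 : R.trace = 1)
    (h2 : (R ^ 2).trace = ((1 - 2 * m : ℝ) : ℂ)) : tsallisEntropy q R = detTsallis q m := by
  have hx : (1 - √(1 - 4 * m)) / 2 * (1 - (1 - √(1 - 4 * m)) / 2) = m := by
    have := Real.sq_sqrt (by linarith : 0 ≤ 1 - 4 * m)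
    linear_combination (-1 / 4) * this
  unfold tsallisEntropy detTsallis binTsallis
  split_ifs
  · exact trace_cfc_of_pow_three_eq hR hx h3 h1 h2 (by simp)
  · rw [trace_cfc_of_pow_three_eq hR hx h3 h1 h2 (f := fun x => x ^ q) (Real.zero_rpow hq.ne')]

/-- The rank-two operator `|ξ⟩⟨ξ| + b |e⟩⟨e|` with `e` a basis vector. -/
theorem tsallisEntropy_vecMulVec_add_single {α : Type*} [Fintype α] [DecidableEq α] (ξ : α → ℂ)
    (o : α) {q N w b : ℝ} (hq : 0 < q) (hN : ∑ u, ‖ξ u‖ ^ 2 = N) (hw : ‖ξ o‖ ^ 2 = w)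
    (hNb : N + b = 1) (hm : (N - w) * b ≤ 1 / 4) :
    tsallisEntropy q (Matrix.vecMulVec ξ (star ξ) + b • Matrix.single o o (1 : ℂ)) =
      detTsallis q ((N - w) * b) := by
  set X := Matrix.vecMulVec ξ (star ξ) with hX
  set E := Matrix.single o o (1 : ℂ) with hE
  have hNc : star ξ ⬝ᵥ ξ = (N : ℂ) := by
    rw [← hN]
    simp only [dotProduct, Pi.star_apply, RCLike.star_def, Complex.ofReal_sum, Complex.ofReal_pow,
      Complex.conj_mul']
  have hwc : ξ o * star (ξ o) = (w : ℂ) := by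
    rw [← hw]
    simp only [RCLike.star_def, Complex.mul_conj', Complex.ofReal_pow]
  -- These four relations reduce every word in `X` and `E` to `X`, `E`, `X E`, `E X`; the
  -- determinant of the rank-two operator is `(N - w) * b`.
  have hXX : X * X = N • X := by
    rw [hX, Matrix.vecMulVec_mul_vecMulVec, hNc]
    ext i j
    simp [Matrix.vecMulVec_apply]
    ring
  have hEE : E * E = E := by simp [hE]
  have hEXE : E * X * E = w • E := by
    ext i j
    rw [hE, Matrix.single_mul_mul_single]
    rw [hX, Matrix.vecMulVec_apply, Pi.star_apply, hwc]
    simp [Matrix.single_apply]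
  have hXEX : X * E * X = w • X := by
    have : E = Matrix.vecMulVec (Pi.single o 1) (Pi.single o 1) :=
      Matrix.single_eq_single_vecMulVec_single o o
    rw [this, hX, Matrix.vecMulVec_mul_vecMulVec, Matrix.vecMulVec_mul_vecMulVec]
    ext i j
    simp [Matrix.vecMulVec_apply, ← hwc]
    ring
  have hXE : (X * E).trace = (w : ℂ) := by
    rw [hE, Matrix.trace_mul_single, hX, Matrix.vecMulVec_apply, Pi.star_apply, hwc]
    simp
  have hEX : (E * X).trace = (w : ℂ) := by rw [Matrix.trace_mul_comm, hXE]
  have htX : X.trace = (N : ℂ) := by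
    rw [hX, Matrix.trace_vecMulVec, dotProduct_comm, hNc]
  have htE : E.trace = 1 := by simp [hE]
  have hR2 : (X + b • E) ^ 2 = N • X + b • (X * E) + b • (E * X) + (b * b) • E := by
    rw [pow_two, add_mul, mul_add, mul_add]
    simp only [smul_mul_assoc, mul_smul_comm, hXX, hEE, smul_smul]
    abel
  apply tsallisEntropy_eq_detTsallis hq ?_ hm
  · rw [pow_succ, hR2]
    simp only [add_mul, mul_add, smul_mul_assoc, mul_smul_comm, hXX, hEXE, hXEX, smul_smul]
    rw [mul_assoc X E E, mul_assoc E X X, hEE, hXX]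
    simp only [mul_smul_comm, smul_smul]
    have hb : b = 1 - N := by linarith
    match_scalars <;> subst hb <;> ring
  · rw [Matrix.trace_add, Matrix.trace_smul, htX, htE, Complex.real_smul, mul_one]
    exact_mod_cast hNb
  · rw [hR2]
    simp only [Matrix.trace_add, Matrix.trace_smul, htX, htE, hXE, hEX]
    have hb : b = 1 - N := by linarith
    subst hb
    simp only [Complex.real_smul]
    push_cast
    ring
  · refine Matrix.IsHermitian.add ?_ ?_
    · ext i j
      simp [hX, Matrix.vecMulVec_apply, Matrix.conjTranspose_apply, mul_comm]
    · ext i j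
      simp only [hE, Matrix.single_apply, Matrix.conjTranspose_apply, Matrix.smul_apply,
        and_comm (a := o = j)]
      split_ifs <;> simp

/-! ### Entanglement of pure states supported on `|u 0⟩` and `|0 v⟩`. -/

section Cross

variable {α β : Type*}

/-- The weight of `ψ` on the vectors `|u 0⟩` with `u ≠ 0`; the basis vectors called `0` are `o`
and `o'`. -/
noncomputable def leftWeight [Fintype α] [DecidableEq α] (o : α) (o' : β) (ψ : α × β → ℂ) : ℝ :=
  ∑ u ∈ Finset.univ.erase o, ‖ψ (u, o')‖ ^ 2

/-- The weight of `ψ` on the vectors `|0 v⟩` with `v ≠ 0`. -/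
noncomputable def rightWeight [Fintype β] [DecidableEq β] (o : α) (o' : β) (ψ : α × β → ℂ) : ℝ :=
  ∑ v ∈ Finset.univ.erase o', ‖ψ (o, v)‖ ^ 2

/-- `ψ` is a combination of `|u 0⟩` and `|0 v⟩`. -/
def IsCross (o : α) (o' : β) (ψ : α × β → ℂ) : Prop :=
  ∀ u v, u ≠ o → v ≠ o' → ψ (u, v) = 0

variable {o : α} {o' : β} {ψ : α × β → ℂ}

theorem rightWeight_nonneg [Fintype β] [DecidableEq β] : 0 ≤ rightWeight o o' ψ := Finset.sum_nonneg fun _ _ => by positivity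

theorem leftWeight_nonneg [Fintype α] [DecidableEq α] : 0 ≤ leftWeight o o' ψ := Finset.sum_nonneg fun _ _ => by positivity

variable [Fintype α] [DecidableEq α] [Fintype β] [DecidableEq β]

theorem IsCross.sum_eq (hψ : IsCross o o' ψ) :
    ∑ x, ‖ψ x‖ ^ 2 = leftWeight o o' ψ + rightWeight o o' ψ + ‖ψ (o, o')‖ ^ 2 := by
  rw [Fintype.sum_prod_type, ← Finset.add_sum_erase _ _ (Finset.mem_univ o),
    ← Finset.add_sum_erase _ _ (Finset.mem_univ o')]
  have : ∀ u ∈ Finset.univ.erase o, ∑ v, ‖ψ (u, v)‖ ^ 2 = ‖ψ (u, o')‖ ^ 2 := by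
    intro u hu
    refine Finset.sum_eq_single o' (fun v _ hv => ?_) (by simp)
    simp [hψ u v (Finset.ne_of_mem_erase hu) hv]
  rw [Finset.sum_congr rfl this, leftWeight, rightWeight]
  ring

/-- In the partial trace, `v = o'` contributes the projector onto `ψ (·, o')`, and every other `v`
only a multiple of `|o⟩⟨o|`, with total `rightWeight`. -/
theorem IsCross.pureTsallisEntanglement_eq (hψ : IsCross o o' ψ) (hu : IsUnitVector ψ) {q : ℝ}
    (hq : 0 < q) :
    pureTsallisEntanglement q ψ = detTsallis q (leftWeight o o' ψ * rightWeight o o' ψ) := by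
  have hsum := hψ.sum_eq
  rw [hu] at hsum
  have hN : ∑ u, ‖ψ (u, o')‖ ^ 2 = leftWeight o o' ψ + ‖ψ (o, o')‖ ^ 2 := by
    rw [← Finset.add_sum_erase _ _ (Finset.mem_univ o), leftWeight, add_comm]
  have hmat : partialTraceRight (ketBra ψ) =
      Matrix.vecMulVec (fun u => ψ (u, o')) (star fun u => ψ (u, o')) +
        rightWeight o o' ψ • Matrix.single o o (1 : ℂ) := by
    ext u u'
    simp only [partialTraceRight, ketBra, Matrix.of_apply, Matrix.add_apply, Matrix.smul_apply,
      Matrix.vecMulVec_apply, Pi.star_apply]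
    rw [← Finset.add_sum_erase _ _ (Finset.mem_univ o')]
    congr 1
    by_cases h : o = u ∧ o = u'
    · obtain ⟨rfl, rfl⟩ := h
      simp [rightWeight, Complex.mul_conj']
    · rw [Matrix.single_apply, if_neg h, smul_zero]
      refine Finset.sum_eq_zero fun v hv => ?_
      have hv' := Finset.ne_of_mem_erase hv
      by_cases hu : u = o
      · have hu' : u' ≠ o := fun h' => h ⟨hu.symm, h'.symm⟩
        simp [hψ u' v hu' hv']
      · simp [hψ u v hu hv']
  have hm := (mul_le_one_div_four (leftWeight_nonneg (o := o) (o' := o') (ψ := ψ))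
    (rightWeight_nonneg (o := o) (o' := o') (ψ := ψ))
    (by linarith [sq_nonneg ‖ψ (o, o')‖])).2
  rw [pureTsallisEntanglement, hmat, tsallisEntropy_vecMulVec_add_single _ o hq hN rfl
    (by linarith) (by simpa using hm)]
  simp

end Cross

/-! ### Pure state decompositions and bounds on the assistance. -/

section Decomposition

theorem ketBra_apply_self {ι : Type*} (ψ : ι → ℂ) (x : ι) :
    ketBra ψ x x = ((‖ψ x‖ ^ 2 : ℝ) : ℂ) := by
  simp [ketBra, Complex.mul_conj']

/-- If a diagonal entry of a mixture vanishes, so does the corresponding amplitude of each of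
its members. -/
theorem apply_eq_zero_of_sum_smul_ketBra {ι κ : Type*} [Fintype κ] {ρ : Matrix ι ι ℂ} {p : κ → ℝ}
    {χ : κ → ι → ℂ} (hp : ∀ k, 0 ≤ p k) (hρ : ρ = ∑ k, (p k : ℂ) • ketBra (χ k)) {x : ι}
    (hx : ρ x x = 0) {k : κ} (hk : p k ≠ 0) : χ k x = 0 := by
  have h : ∑ k, p k * ‖χ k x‖ ^ 2 = 0 := by
    rw [hρ, Matrix.sum_apply] at hx
    simp only [Matrix.smul_apply, ketBra_apply_self, smul_eq_mul] at hx
    exact_mod_cast hx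
  have := (Finset.sum_eq_zero_iff_of_nonneg fun k _ =>
    mul_nonneg (hp k) (sq_nonneg ‖χ k x‖)).1 h k (Finset.mem_univ k)
  simpa [hk] using this

variable {α β : Type*} {o : α} {o' : β} {q : ℝ} {ρ : Matrix (α × β) (α × β) ℂ}

theorem isCross_of_sum_smul_ketBra {κ : Type*} [Fintype κ] {p : κ → ℝ}
    {χ : κ → α × β → ℂ} (hp : ∀ k, 0 ≤ p k) (hρ : ρ = ∑ k, (p k : ℂ) • ketBra (χ k))
    (hc : ∀ u v, u ≠ o → v ≠ o' → ρ (u, v) (u, v) = 0) {k : κ} (hk : p k ≠ 0) :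
    IsCross o o' (χ k) := fun u v hu hv =>
  apply_eq_zero_of_sum_smul_ketBra hp hρ (hc u v hu hv) hk

variable [Fintype α] [DecidableEq α] [Fintype β] [DecidableEq β]

/-- The factor `p i` stays on both sides because a member of zero probability is not forced to be a
cross vector. -/
theorem IsPureDecomposition.mul_pureTsallisEntanglement_eq (hq : 0 < q)
    (hc : ∀ u v, u ≠ o → v ≠ o' → ρ (u, v) (u, v) = 0) {N : ℕ} {p : Fin N → ℝ}
    {ψ : Fin N → α × β → ℂ} (h : IsPureDecomposition ρ p ψ) (i : Fin N) :
    p i * pureTsallisEntanglement q (ψ i) =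
      p i * detTsallis q (leftWeight o o' (ψ i) * rightWeight o o' (ψ i)) := by
  by_cases hi : p i = 0
  · simp [hi]
  · rw [(isCross_of_sum_smul_ketBra h.nonneg h.eq_sum hc hi).pureTsallisEntanglement_eq
      (h.unit i) hq]

theorem IsCross.weight_mul_mem {ψ : α × β → ℂ} (hψ : IsCross o o' ψ) (hu : IsUnitVector ψ) :
    leftWeight o o' ψ * rightWeight o o' ψ ∈ Set.Icc (0 : ℝ) (1 / 4) := by
  have hsum := hψ.sum_eq
  rw [hu] at hsum
  exact mul_le_one_div_four leftWeight_nonneg rightWeight_nonneg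
    (by linarith [sq_nonneg ‖ψ (o, o')‖])

/-- The upper bound makes the set in `tsallisAssistance` bounded above; without it `sSup` would take
its default value `0`. -/
theorem IsPureDecomposition.average_mem (hq0 : 0 < q) (hq : q ≤ 2 ∨ 3 ≤ q)
    (hc : ∀ u v, u ≠ o → v ≠ o' → ρ (u, v) (u, v) = 0) {N : ℕ} {p : Fin N → ℝ}
    {ψ : Fin N → α × β → ℂ} (h : IsPureDecomposition ρ p ψ) :
    ∑ i, p i * pureTsallisEntanglement q (ψ i) ∈ Set.Icc 0 (detTsallis q (1 / 4)) := by
  have hi : ∀ i, 0 ≤ p i * pureTsallisEntanglement q (ψ i) ∧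
      p i * pureTsallisEntanglement q (ψ i) ≤ p i * detTsallis q (1 / 4) := by
    intro i
    rw [h.mul_pureTsallisEntanglement_eq hq0 hc]
    by_cases hi : p i = 0
    · simp [hi]
    have hm := (isCross_of_sum_smul_ketBra h.nonneg h.eq_sum hc hi).weight_mul_mem (h.unit i)
    exact ⟨mul_nonneg (h.nonneg i) (detTsallis_nonneg hq0 hq hm),
      mul_le_mul_of_nonneg_left ((concaveOn_monotoneOn_detTsallis hq0 hq).2 hm
        ⟨by norm_num, le_rfl⟩ hm.2) (h.nonneg i)⟩
  refine ⟨Finset.sum_nonneg fun i _ => (hi i).1, ?_⟩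
  calc _ ≤ ∑ i, p i * detTsallis q (1 / 4) := Finset.sum_le_sum fun i _ => (hi i).2
    _ = _ := by rw [← Finset.sum_mul, h.sum_eq_one, one_mul]

theorem tsallisAssistance_nonneg (hq0 : 0 < q) (hq : q ≤ 2 ∨ 3 ≤ q)
    (hc : ∀ u v, u ≠ o → v ≠ o' → ρ (u, v) (u, v) = 0) : 0 ≤ tsallisAssistance q ρ := by
  apply Real.sSup_nonneg
  rintro t ⟨N, p, ψ, h, rfl⟩
  exact (h.average_mem hq0 hq hc).1

/-- A lower bound for the entanglement of assistance from a decomposition into vectors that need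
not be normalized. -/
theorem le_tsallisAssistance (hq0 : 0 < q) (hq : q ≤ 2 ∨ 3 ≤ q)
    (hc : ∀ u v, u ≠ o → v ≠ o' → ρ (u, v) (u, v) = 0) {κ : Type*} [Fintype κ]
    {p : κ → ℝ} {χ : κ → α × β → ℂ} (hp : ∀ k, 0 ≤ p k)
    (hρ : ρ = ∑ k, (p k : ℂ) • ketBra (χ k)) (h1 : ∑ k, p k * ∑ x, ‖χ k x‖ ^ 2 = 1) :
    ∑ k, p k * ((∑ x, ‖χ k x‖ ^ 2) * detTsallis q
      (leftWeight o o' (χ k) * rightWeight o o' (χ k) / (∑ x, ‖χ k x‖ ^ 2) ^ 2)) ≤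
      tsallisAssistance q ρ := by
  set n : κ → ℝ := fun k => ∑ x, ‖χ k x‖ ^ 2 with hn
  have hn0 : ∀ k, 0 ≤ n k := fun k => Finset.sum_nonneg fun _ _ => by positivity
  -- A zero vector is replaced by an arbitrary unit vector; its new probability `p k * n k` is `0`.
  set φ : κ → α × β → ℂ := fun k =>
    if n k = 0 then Pi.single (o, o') 1 else fun x => χ k x / (√(n k) : ℂ) with hφ
  have hχ0 : ∀ k, n k = 0 → χ k = 0 := by
    intro k hk
    funext x
    have := (Finset.sum_eq_zero_iff_of_nonneg fun x _ => sq_nonneg ‖χ k x‖).1 hk x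
      (Finset.mem_univ x)
    simpa using this
  have hnorm : ∀ k, n k ≠ 0 → ∀ x, ‖φ k x‖ ^ 2 = ‖χ k x‖ ^ 2 / n k := by
    intro k hk x
    simp only [hφ, if_neg hk, norm_div, div_pow, Complex.norm_real, Real.norm_eq_abs, sq_abs,
      Real.sq_sqrt (hn0 k)]
  set e := Fintype.equivFin κ
  have hdec : IsPureDecomposition ρ (fun i => p (e.symm i) * n (e.symm i))
      (fun i => φ (e.symm i)) := by
    constructor
    · exact fun i => mul_nonneg (hp _) (hn0 _)
    · rw [Equiv.sum_comp e.symm fun k => p k * n k]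
      exact h1
    · intro i
      generalize e.symm i = k
      unfold IsUnitVector
      by_cases hk : n k = 0
      · simp only [hφ, if_pos hk]
        rw [Finset.sum_eq_single (o, o')] <;> simp +contextual
      · simp only [hnorm k hk, ← Finset.sum_div]
        exact div_self hk
    · rw [Equiv.sum_comp e.symm fun k => ((p k * n k : ℝ) : ℂ) • ketBra (φ k), hρ]
      refine Finset.sum_congr rfl fun k _ => ?_
      by_cases hk : n k = 0
      · rw [hχ0 k hk, hk]
        ext x y
        simp [ketBra]
      · ext x y
        have hs : (√(n k) : ℂ) * (√(n k) : ℂ) = (n k : ℂ) := by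
          rw [← Complex.ofReal_mul, Real.mul_self_sqrt (hn0 k)]
        have hs0 : (√(n k) : ℂ) ≠ 0 := by
          intro h
          rw [h, mul_zero] at hs
          exact hk (by exact_mod_cast hs.symm)
        simp only [Matrix.smul_apply, ketBra, Matrix.of_apply, hφ, if_neg hk, smul_eq_mul,
          Complex.ofReal_mul, ← hs, star_div₀, RCLike.star_def, Complex.conj_ofReal]
        field_simp
  have hle : ∑ i, p (e.symm i) * n (e.symm i) * pureTsallisEntanglement q (φ (e.symm i)) ≤
      tsallisAssistance q ρ := by
    apply le_csSup
    · refine ⟨detTsallis q (1 / 4), ?_⟩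
      rintro t ⟨N, p, ψ, h, rfl⟩
      exact (h.average_mem hq0 hq hc).2
    · exact ⟨_, _, _, hdec, rfl⟩
  refine le_trans (le_of_eq ?_) hle
  rw [← Equiv.sum_comp e.symm]
  refine Finset.sum_congr rfl fun i _ => ?_
  rw [hdec.mul_pureTsallisEntanglement_eq hq0 hc, mul_assoc]
  generalize e.symm i = k
  by_cases hk : n k = 0
  · have hk' : ∑ x, ‖χ k x‖ ^ 2 = 0 := hk
    simp only [hk, hk', zero_mul]
  · congr 3
    have e1 : leftWeight o o' (φ k) = leftWeight o o' (χ k) / n k := by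
      simp only [leftWeight, hnorm k hk, Finset.sum_div]
    have e2 : rightWeight o o' (φ k) = rightWeight o o' (χ k) / n k := by
      simp only [rightWeight, hnorm k hk, Finset.sum_div]
    rw [e1, e2, div_mul_div_comm, sq]

end Decomposition

/-! ### Reduced states of single-excitation vectors and polygamy for `μ = 1`. -/

/-- Used for `B ≤ ∑ b_j`: values hit more than once only enlarge the right side. -/
theorem sum_le_sum_comp_of_subset_image {ι κ : Type*} {s : Finset ι} {t : Finset κ}
    {F : ι → ℝ} (hF : ∀ v, 0 ≤ F v) (f : κ → ι)
    (h : ∀ v ∈ s, F v ≠ 0 → ∃ k ∈ t, f k = v) : ∑ v ∈ s, F v ≤ ∑ k ∈ t, F (f k) := by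
  classical
  rcases isEmpty_or_nonempty κ with hκ | hκ
  · rw [Finset.sum_eq_zero fun v hv => by_contra fun hne => hκ.elim (h v hv hne).choose]
    exact Finset.sum_nonneg fun _ _ => hF _
  choose! g hg hfg using h
  have hfg' : ∀ v ∈ s.filter (fun v => F v ≠ 0), f (g v) = v := fun v hv =>
    hfg v (Finset.mem_filter.1 hv).1 (Finset.mem_filter.1 hv).2
  calc ∑ v ∈ s, F v = ∑ v ∈ s.filter (fun v => F v ≠ 0), F (f (g v)) := by
        rw [← Finset.sum_filter_ne_zero]
        exact Finset.sum_congr rfl fun v hv => by rw [hfg' v hv]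
    _ = ∑ k ∈ (s.filter (fun v => F v ≠ 0)).image g, F (f k) := by
        rw [Finset.sum_image]
        intro v hv v' hv' he
        rw [← hfg' v hv, ← hfg' v' hv', he]
    _ ≤ _ := by
        refine Finset.sum_le_sum_of_subset_of_nonneg ?_ fun k _ _ => hF _
        intro k hk
        obtain ⟨v, hv, rfl⟩ := Finset.mem_image.1 hk
        exact hg v (Finset.mem_filter.1 hv).1 (Finset.mem_filter.1 hv).2

section Reduced

variable {n d : ℕ}

/-- The configuration on `S'` that is `v` on `S` and `z` elsewhere. -/
def extendConfig {S S' : Finset (Fin n)} (v : S → Fin d)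
    (z : {i : Fin n // i ∈ S' ∧ i ∉ S} → Fin d) : S' → Fin d := fun i =>
  if h : (i : Fin n) ∈ S then v ⟨i, h⟩ else z ⟨i, i.2, h⟩

/-- Configurations on `S'` are pairs of configurations on `S` and on `S' \ S`. -/
def extendConfigEquiv {S S' : Finset (Fin n)} (hS : S ⊆ S') :
    (S → Fin d) × ({i : Fin n // i ∈ S' ∧ i ∉ S} → Fin d) ≃ (S' → Fin d) where
  toFun x := extendConfig x.1 x.2
  invFun y := (fun i => y ⟨i, hS i.2⟩, fun i => y ⟨i, i.2.1⟩)
  left_inv x := by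
    ext i
    · simp [extendConfig]
    · simp [extendConfig, i.2.2]
  right_inv y := by
    ext i
    simp only [extendConfig]
    split_ifs <;> rfl

theorem extendConfig_zero [NeZero d] {S S' : Finset (Fin n)} :
    extendConfig (0 : S → Fin d) (0 : {i : Fin n // i ∈ S' ∧ i ∉ S} → Fin d) = 0 := by
  funext i
  simp only [extendConfig]
  split_ifs <;> rfl

/-- Configurations outside `A ∪ S` are pairs of configurations on `S' \ S` and outside
`A ∪ S'`. -/
def complConfigEquiv {A S S' : Finset (Fin n)} (hS : S ⊆ S') (hA : Disjoint A S') :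
    ({i : Fin n // i ∉ A ∧ i ∉ S} → Fin d) ≃
      ({i : Fin n // i ∈ S' ∧ i ∉ S} → Fin d) × ({i : Fin n // i ∉ A ∧ i ∉ S'} → Fin d) where
  toFun y := (fun i => y ⟨i, Finset.disjoint_right.1 hA i.2.1, i.2.2⟩,
    fun i => y ⟨i, i.2.1, fun h => i.2.2 (hS h)⟩)
  invFun x i := if h : (i : Fin n) ∈ S' then x.1 ⟨i, h, i.2.2⟩ else x.2 ⟨i, i.2.1, h⟩
  left_inv y := by
    ext i
    simp only
    split_ifs <;> rfl
  right_inv x := by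
    ext i
    · simp [i.2.1]
    · simp [i.2.2]

theorem reducedState_apply (ψ : (Fin n → Fin d) → ℂ) (A B : Finset (Fin n))
    (x y : (A → Fin d) × (B → Fin d)) :
    reducedState ψ A B x y =
      ∑ z, ψ (glue A B x.1 x.2 z) * star (ψ (glue A B y.1 y.2 z)) := rfl

/-- Tracing out part of the second subsystem. -/
theorem reducedState_eq_sum (ψ : (Fin n → Fin d) → ℂ) {A S S' : Finset (Fin n)} (hS : S ⊆ S')
    (hA : Disjoint A S') (x y : (A → Fin d) × (S → Fin d)) :
    reducedState ψ A S x y = ∑ z : {i : Fin n // i ∈ S' ∧ i ∉ S} → Fin d,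
      reducedState ψ A S' (x.1, extendConfig x.2 z) (y.1, extendConfig y.2 z) := by
  have hg : ∀ (u : A → Fin d) (v : S → Fin d) (z : {i : Fin n // i ∈ S' ∧ i ∉ S} → Fin d)
      (z' : {i : Fin n // i ∉ A ∧ i ∉ S'} → Fin d),
      glue A S u v ((complConfigEquiv hS hA).symm (z, z')) =
        glue A S' u (extendConfig v z) z' := by
    intro u v z z'
    funext i
    simp only [glue, extendConfig, complConfigEquiv, Equiv.coe_fn_symm_mk]
    by_cases h1 : i ∈ A
    · simp [h1]
    by_cases h2 : i ∈ S
    · simp [h1, h2, hS h2]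
    · simp [h1, h2]
  simp only [reducedState_apply]
  rw [← Equiv.sum_comp (complConfigEquiv hS hA).symm, Fintype.sum_prod_type]
  simp only [hg]

/-- `ψ` has no component on basis vectors with two nonzero entries. -/
def IsSingleExcitation [NeZero d] (ψ : (Fin n → Fin d) → ℂ) : Prop :=
  ∀ x : Fin n → Fin d, ∀ i j, i ≠ j → x i ≠ 0 → x j ≠ 0 → ψ x = 0

theorem IsGWV.isSingleExcitation [NeZero d] {ψ : (Fin n → Fin d) → ℂ} (hψ : IsGWV ψ) :
    IsSingleExcitation ψ := by
  obtain ⟨p, a, -, -, -, rfl⟩ := hψ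
  intro x i j hij hi hj
  have h0 : ket (0 : Fin n → Fin d) x = 0 := by
    rw [ket, Pi.single_apply, if_neg]
    rintro rfl
    exact hi rfl
  have hs : ∀ (s : Fin n) (c : Fin d), ket (Pi.single s c : Fin n → Fin d) x = 0 := by
    intro s c
    rw [ket, Pi.single_apply, if_neg]
    rintro rfl
    by_cases h : i = s
    · exact hj (Pi.single_eq_of_ne (M := fun _ => Fin d) (fun h' => hij (h.trans h'.symm)) _)
    · exact hi (Pi.single_eq_of_ne (M := fun _ => Fin d) h _)
  simp [wVector, h0, hs]

variable {ψ : (Fin n → Fin d) → ℂ} {A B : Finset (Fin n)}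

/-- The part of `φ` in which the qudits of `S' \ S` are in the configuration `z`. -/
def condition {S S' : Finset (Fin n)} (φ : (A → Fin d) × (S' → Fin d) → ℂ)
    (z : {i : Fin n // i ∈ S' ∧ i ∉ S} → Fin d) : (A → Fin d) × (S → Fin d) → ℂ := fun x =>
  φ (x.1, extendConfig x.2 z)

theorem sum_condition {S S' : Finset (Fin n)} (hS : S ⊆ S')
    (φ : (A → Fin d) × (S' → Fin d) → ℂ) :
    ∑ z : {i : Fin n // i ∈ S' ∧ i ∉ S} → Fin d, ∑ x, ‖condition φ z x‖ ^ 2 =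
      ∑ x, ‖φ x‖ ^ 2 := by
  simp only [condition, Fintype.sum_prod_type]
  rw [Finset.sum_comm]
  refine Finset.sum_congr rfl fun u _ => ?_
  rw [Finset.sum_comm, ← Equiv.sum_comp (extendConfigEquiv hS), Fintype.sum_prod_type]
  rfl

variable [NeZero d]

theorem IsSingleExcitation.reducedState_cross (hψ : IsSingleExcitation ψ) (hAB : Disjoint A B)
    (u : A → Fin d) (v : B → Fin d) (hu : u ≠ 0) (hv : v ≠ 0) :
    reducedState ψ A B (u, v) (u, v) = 0 := by
  obtain ⟨i, hi⟩ := Function.ne_iff.1 hu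
  obtain ⟨j, hj⟩ := Function.ne_iff.1 hv
  have hjA : (j : Fin n) ∉ A := Finset.disjoint_right.1 hAB j.2
  rw [reducedState_apply]
  refine Finset.sum_eq_zero fun z _ => ?_
  rw [hψ (glue A B u v z) i j (fun h => hjA (h ▸ i.2)) (by simpa [glue] using hi)
    (by simpa [glue, hjA] using hj), zero_mul]

/-- Forces a configuration on `B` of nonzero amplitude to have at most one excited site, so that it
can be assigned to one block. -/
theorem IsSingleExcitation.reducedState_right (hψ : IsSingleExcitation ψ) (hAB : Disjoint A B)
    (u : A → Fin d) (v : B → Fin d) {i j : B} (hij : i ≠ j) (hi : v i ≠ 0) (hj : v j ≠ 0) :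
    reducedState ψ A B (u, v) (u, v) = 0 := by
  have hA : ∀ k : B, (k : Fin n) ∉ A := fun k => Finset.disjoint_right.1 hAB k.2
  rw [reducedState_apply]
  refine Finset.sum_eq_zero fun z _ => ?_
  rw [hψ (glue A B u v z) i j (fun h => hij (Subtype.ext h)) (by simpa [glue, hA] using hi)
    (by simpa [glue, hA] using hj), zero_mul]

theorem leftWeight_condition {S S' : Finset (Fin n)} (φ : (A → Fin d) × (S' → Fin d) → ℂ) :
    leftWeight 0 0 (condition (S := S) φ 0) = leftWeight 0 0 φ := by
  simp only [leftWeight, condition, extendConfig_zero]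

/-- Measuring the qudits of `S' \ S` in the computational basis and keeping only the outcome `0`
bounds the entanglement of assistance with `S` from below. -/
theorem IsSingleExcitation.sum_condition_le_tsallisAssistance (hψ : IsSingleExcitation ψ)
    {q : ℝ} (hq0 : 0 < q) (hq : q ≤ 2 ∨ 3 ≤ q) {S S' : Finset (Fin n)} (hS : S ⊆ S')
    (hA : Disjoint A S') {N : ℕ} {p : Fin N → ℝ} {φ : Fin N → (A → Fin d) × (S' → Fin d) → ℂ}
    (h : IsPureDecomposition (reducedState ψ A S') p φ) :
    ∑ i, p i * ((∑ x, ‖condition (S := S) (φ i) 0 x‖ ^ 2) * detTsallis q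
      (leftWeight 0 0 (φ i) * rightWeight 0 0 (condition (S := S) (φ i) 0) /
        (∑ x, ‖condition (S := S) (φ i) 0 x‖ ^ 2) ^ 2)) ≤
      tsallisAssistance q (reducedState ψ A S) := by
  set κ := Fin N × ({i : Fin n // i ∈ S' ∧ i ∉ S} → Fin d)
  -- Tracing out `S' \ S` turns each member into the mixture of its unnormalized measurement
  -- outcomes.
  have hρ : reducedState ψ A S = ∑ k : κ, (p k.1 : ℂ) • ketBra (condition (φ k.1) k.2) := by
    ext x y
    rw [reducedState_eq_sum ψ hS hA, h.eq_sum, Fintype.sum_prod_type, Finset.sum_comm]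
    simp only [Matrix.sum_apply]
    rfl
  have hcross := hψ.reducedState_cross (hA.mono_right hS)
  have h1 : ∑ k : κ, p k.1 * ∑ x, ‖condition (φ k.1) k.2 x‖ ^ 2 = 1 := by
    rw [Fintype.sum_prod_type, ← h.sum_eq_one]
    refine Finset.sum_congr rfl fun i _ => ?_
    simp only
    rw [← Finset.mul_sum, sum_condition hS, show ∑ x, ‖φ i x‖ ^ 2 = 1 from h.unit i, mul_one]
  have hp : ∀ k : κ, 0 ≤ p k.1 := fun k => h.nonneg _
  refine le_trans ?_ (le_tsallisAssistance (o := 0) (o' := 0) hq0 hq hcross hp hρ h1)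
  rw [Fintype.sum_prod_type]
  refine Finset.sum_le_sum fun i _ => ?_
  rw [← leftWeight_condition (S := S) (φ i)]
  refine Finset.single_le_sum (f := fun z => p i * ((∑ x, ‖condition (φ i) z x‖ ^ 2) *
    detTsallis q (leftWeight 0 0 (condition (φ i) z) * rightWeight 0 0 (condition (φ i) z) /
      (∑ x, ‖condition (φ i) z x‖ ^ 2) ^ 2))) (fun z _ => ?_) (Finset.mem_univ 0)
  by_cases hi : p i = 0
  · simp [hi]
  have hz := isCross_of_sum_smul_ketBra hp hρ hcross (k := (i, z)) hi
  have hn : 0 ≤ ∑ x, ‖condition (φ i) z x‖ ^ 2 := Finset.sum_nonneg fun _ _ => by positivity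
  refine mul_nonneg (h.nonneg i) (mul_nonneg hn (detTsallis_nonneg hq0 hq ?_))
  have hs := hz.sum_eq
  simp only at hs
  have hl := leftWeight_nonneg (o := 0) (o' := 0) (ψ := condition (φ i) z)
  have hr := rightWeight_nonneg (o := 0) (o' := 0) (ψ := condition (φ i) z)
  rcases hn.eq_or_lt with h0 | h0
  · rw [← h0]; norm_num
  · rw [sq, ← div_mul_div_comm]
    refine mul_le_one_div_four (by positivity) (by positivity) ?_
    rw [← add_div, div_le_one h0, hs]
    linarith [sq_nonneg ‖condition (φ i) z (0, 0)‖]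

/-- Polygamy of the Tsallis-`q` entanglement of assistance. -/
theorem IsSingleExcitation.tsallisAssistance_le_sum (hψ : IsSingleExcitation ψ)
    {q : ℝ} (hq0 : 0 < q) (hq : q ≤ 2 ∨ 3 ≤ q) {r : ℕ} {P : Finset (Fin n)}
    {Q : Fin r → Finset (Fin n)} (hPQ : ∀ j, Disjoint P (Q j)) :
    tsallisAssistance q (reducedState ψ P (Finset.univ.biUnion Q)) ≤
      ∑ j, tsallisAssistance q (reducedState ψ P (Q j)) := by
  set S' := Finset.univ.biUnion Q with hS'
  have hA : Disjoint P S' := (Finset.disjoint_biUnion_right _ _ _).2 fun j _ => hPQ j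
  have hS : ∀ j, Q j ⊆ S' := fun j => Finset.subset_biUnion_of_mem Q (Finset.mem_univ j)
  apply Real.sSup_le
  swap
  · exact Finset.sum_nonneg fun j _ =>
      tsallisAssistance_nonneg hq0 hq (hψ.reducedState_cross (hPQ j))
  rintro t ⟨N, p, φ, h, rfl⟩
  refine le_trans ?_ (Finset.sum_le_sum fun j _ =>
    hψ.sum_condition_le_tsallisAssistance hq0 hq (hS j) hA h)
  rw [Finset.sum_comm]
  refine Finset.sum_le_sum fun i _ => ?_
  rw [h.mul_pureTsallisEntanglement_eq hq0 (hψ.reducedState_cross hA), ← Finset.mul_sum]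
  by_cases hi : p i = 0
  · simp [hi]
  refine mul_le_mul_of_nonneg_left ?_ (h.nonneg i)
  have hcross := isCross_of_sum_smul_ketBra h.nonneg h.eq_sum (hψ.reducedState_cross hA) hi
  have hsum := hcross.sum_eq
  rw [h.unit i] at hsum
  have hb : ∀ j, rightWeight 0 0 (condition (S := Q j) (φ i) 0) ≤ rightWeight 0 0 (φ i) := by
    intro j
    have hinj : Function.Injective fun v : Q j → Fin d => extendConfig (S' := S') v 0 :=
      fun v v' hv => (Prod.ext_iff.1 ((extendConfigEquiv (hS j)).injective
        (a₁ := (v, 0)) (a₂ := (v', 0)) hv)).1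
    rw [rightWeight, rightWeight]
    refine le_trans (le_of_eq ?_) (Finset.sum_le_sum_of_subset_of_nonneg
      (s := (Finset.univ.erase 0).image fun v : Q j → Fin d => extendConfig v 0) ?_
      fun _ _ _ => by positivity)
    · rw [Finset.sum_image fun _ _ _ _ hv => hinj hv]
      rfl
    · intro v hv
      obtain ⟨v', hv', rfl⟩ := Finset.mem_image.1 hv
      refine Finset.mem_erase.2 ⟨fun h0 => Finset.ne_of_mem_erase hv' (hinj ?_),
        Finset.mem_univ _⟩
      exact h0.trans extendConfig_zero.symm
  -- A `v ≠ 0` of nonzero amplitude is excited at a single site `s`; choosing `Q j ∋ s`, it is the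
  -- extension by `0` of its restriction to `Q j`.
  have hB : rightWeight 0 0 (φ i) ≤ ∑ j, rightWeight 0 0 (condition (S := Q j) (φ i) 0) := by
    simp only [rightWeight]
    rw [Finset.sum_sigma']
    refine sum_le_sum_comp_of_subset_image (F := fun v => ‖φ i (0, v)‖ ^ 2)
      (fun _ => by positivity) (fun k : (j : Fin r) × (Q j → Fin d) => extendConfig k.2 0) ?_
    intro v hv hF
    obtain ⟨s, hs⟩ := Function.ne_iff.1 (Finset.ne_of_mem_erase hv)
    obtain ⟨j, -, hj⟩ := Finset.mem_biUnion.1 s.2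
    have hv0 : ∀ k, k ≠ s → v k = 0 := by
      intro k hk
      by_contra hne
      refine hF ?_
      simp [apply_eq_zero_of_sum_smul_ketBra h.nonneg h.eq_sum
        (hψ.reducedState_right hA 0 v hk hne hs) hi]
    refine ⟨⟨j, fun k => v ⟨k, hS j k.2⟩⟩, ?_, ?_⟩
    · simp only [Finset.mem_sigma, Finset.mem_univ, true_and, Finset.mem_erase, and_true]
      exact Function.ne_iff.2 ⟨⟨s, hj⟩, hs⟩
    · funext k
      simp only [extendConfig]
      split_ifs with hk
      · rfl
      · exact (hv0 k fun hks => hk (hks ▸ hj)).symm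
  -- The conditioned vector keeps the left weight and the amplitude at `(0, 0)`, so its squared norm
  -- is `A + b_j + w`, as in `div_mul_detTsallis_le`.
  have hj : ∀ j, rightWeight 0 0 (condition (S := Q j) (φ i) 0) / rightWeight 0 0 (φ i) *
      detTsallis q (leftWeight 0 0 (φ i) * rightWeight 0 0 (φ i)) ≤
      (∑ x, ‖condition (S := Q j) (φ i) 0 x‖ ^ 2) * detTsallis q
      (leftWeight 0 0 (φ i) * rightWeight 0 0 (condition (S := Q j) (φ i) 0) /
        (∑ x, ‖condition (S := Q j) (φ i) 0 x‖ ^ 2) ^ 2) := by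
    intro j
    have hcj : IsCross 0 0 (condition (S := Q j) (φ i) 0) := by
      intro u v hu hv
      obtain ⟨k, hk⟩ := Function.ne_iff.1 hv
      refine hcross u _ hu (Function.ne_iff.2 ⟨⟨k, hS j k.2⟩, ?_⟩)
      simpa [extendConfig] using hk
    rw [hcj.sum_eq, leftWeight_condition]
    refine div_mul_detTsallis_le hq0 hq leftWeight_nonneg (by positivity) rightWeight_nonneg
      (hb j) ?_
    rw [hsum]
    simp [condition, extendConfig_zero]
  refine le_trans ?_ (Finset.sum_le_sum fun j _ => hj j)
  rw [← Finset.sum_mul, ← Finset.sum_div]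
  have hg := detTsallis_nonneg hq0 hq (hcross.weight_mul_mem (h.unit i))
  -- If `B = 0`, the quotients are `0` by convention, but `g (A B) = g 0 = 0` as well.
  rcases (rightWeight_nonneg (o := 0) (o' := 0) (ψ := φ i)).eq_or_lt with h0 | h0
  · simp [← h0, detTsallis_zero hq0]
  · exact le_mul_of_one_le_left hg ((one_le_div h0).2 hB)

end Reduced

/-! ### The weighted polygamy inequality. -/

theorem theorem6 {n d : ℕ} [NeZero d] (ψ : (Fin n → Fin d) → ℂ) (hψ : IsGWV ψ)
    {r : ℕ} (hr : 1 ≤ r) (P : Finset (Fin n)) (Q : Fin r → Finset (Fin n))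
    (hP : P.Nonempty) (hQ : ∀ j, (Q j).Nonempty)
    (hPQ : ∀ j, Disjoint P (Q j)) (hQQ : ∀ i j, i ≠ j → Disjoint (Q i) (Q j))
    (q μ k : ℝ)
    (hq : q ∈ Set.Icc ((5 - Real.sqrt 13) / 2) 2 ∪ Set.Icc 3 ((5 + Real.sqrt 13) / 2))
    (hμ0 : 0 < μ) (hμ1 : μ ≤ 1) (hk0 : 0 < k) (hk1 : k ≤ 1)
    (hcond : ∀ l : Fin r, (l : ℕ) + 1 < r →
      ∑ j ∈ Finset.Ioi l, tsallisAssistance q (reducedState ψ P (Q j)) ≤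
        k * tsallisAssistance q (reducedState ψ P (Q l))) :
    tsallisAssistance q (reducedState ψ P (Finset.univ.biUnion Q)) ^ μ ≤
      ∑ j : Fin r, (((1 + k) ^ μ - 1) / k ^ μ) ^ (j : ℕ) *
        tsallisAssistance q (reducedState ψ P (Q j)) ^ μ := by
  -- Makes the left endpoint `(5 - √13) / 2` of the range of `q` positive.
  have h13 : √13 < 5 := (Real.sqrt_lt' (by norm_num)).2 (by norm_num)
  have hq0 : 0 < q := by
    rcases hq with h | h
    · linarith [h.1]
    · linarith [h.1]
  have hq' : q ≤ 2 ∨ 3 ≤ q := hq.imp (fun h => h.2) (fun h => h.1)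
  have hs := hψ.isSingleExcitation
  have hA : Disjoint P (Finset.univ.biUnion Q) :=
    (Finset.disjoint_biUnion_right _ _ _).2 fun j _ => hPQ j
  exact (Real.rpow_le_rpow (tsallisAssistance_nonneg hq0 hq' (hs.reducedState_cross hA))
    (hs.tsallisAssistance_le_sum hq0 hq' hPQ) hμ0.le).trans
    (rpow_sum_le_sum_pow_mul_rpow hk0 hμ0 hμ1 _
      (fun j => tsallisAssistance_nonneg hq0 hq' (hs.reducedState_cross (hPQ j))) hcond)
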